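/- Let $\mathbb D=\{z\in\mathbb C:|z|<1\}$ and let $dA$ denote Lebesgue area measure. For a nonzero polynomial $P$ with complex coefficients put $$\|P\|_0:=\exp\left(\frac1\pi\iint_{\mathbb D}\log|P(z)|\,dA(z)\right),$$ and put $\|0\|_0:=0$. Let $n\ge 0$ be an integer. Then for every polynomial $P_n$ with complex coefficients of degree at most $n$, $$\|zP_n'\|_0\le n\,\|P_n\|_0\qquad\text{and}\qquad \|P_n'\|_0\le\sqrt e\,n\,\|P_n\|_0 .$$ Equality holds in both inequalities for $P_n(z)=z^n$. -/

import Mathlib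

open Polynomial

/-- The areal Mahler measure (the `A⁰` Bergman space "norm") of a complex polynomial `P`:
`exp ((1 / π) ∬_{|z| < 1} log |P z| dA)` with `dA` the Lebesgue area measure on `ℂ`.
For `P ≠ 0` the function `log |P|` is integrable over the unit disk; for `P = 0` the integral is
`-∞` and the value is `exp (-∞) = 0`. -/
noncomputable def arealMahlerMeasure (P : ℂ[X]) : ℝ :=
  if P = 0 then 0
  else Real.exp ((1 / Real.pi) * ∫ z in Metric.ball (0 : ℂ) 1, Real.log ‖P.eval z‖)

/-!
In polar coordinates, `log (arealMahlerMeasure P)` is the average of the logarithmic Mahler measures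
of the dilations `Q(z) = P(r z)` over `0 < r < 1`, with weight `2 r dr`. The operator `P ↦ z P'`
commutes with dilations and the factor `z` does not affect the Mahler measure, so the first
inequality follows from Mahler's inequality `M(Q') ≤ n M(Q)` on the unit circle, applied for each `r`
(`mahlerMeasure_derivative_le`, `arealMahlerMeasure_le_of_dilations`).

Mahler's inequality is Bernstein's comparison argument. Reflecting the zeros of `Q` that lie outside
the unit disk gives a polynomial `R` of the same degree with all its zeros in the closed disk,
`|Q| ≤ |R|` outside the disk, and `M(Q) = M(R) = |lead R|` (`exists_reflection`). A combination of
`Q` and `R` dominated by its `R`-term has no zeros outside the disk, and by Gauss–Lucas neither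
does its derivative; hence `|Q'| ≤ |R'|` on the circle (`norm_eval_derivative_le_of_one_le`). The
zeros of `R'` also lie in the closed disk, so `M(Q') ≤ M(R') = n |lead R| = n M(Q)`.

The second inequality follows from the first because the areal Mahler measure is multiplicative
(`arealMahlerMeasure_mul`, which uses that `log |P|` is integrable on the disk) and that of `z` is
`exp (-1/2)`. For `z ^ n` equality holds since `z (z ^ n)' = n z ^ n`.
-/

/-! ### Bernstein's comparison of derivatives -/

/-- By the Gauss–Lucas theorem and convexity of the disk: if the zeros of a nonconstant polynomial lie
in the closed unit disk, so do those of its derivative. -/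
theorem norm_le_one_of_eval_derivative_eq_zero {R : ℂ[X]} (hdeg : 0 < R.degree)
    (hroots : ∀ w, R.eval w = 0 → ‖w‖ ≤ 1) {z : ℂ} (hz : (derivative R).eval z = 0) :
    ‖z‖ ≤ 1 := by
  have hR : R ≠ 0 := by rintro rfl; simp at hdeg
  have hR' : derivative R ≠ 0 := by
    rw [Ne, derivative_eq_zero, natDegree_eq_zero_iff_degree_le_zero]
    exact not_le.mpr hdeg
  have hmem := rootSet_derivative_subset_convexHull_rootSet hdeg
    (show z ∈ (derivative R).rootSet ℂ by rw [mem_rootSet]; exact ⟨hR', by simpa using hz⟩)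
  have hsub : R.rootSet ℂ ⊆ Metric.closedBall (0 : ℂ) 1 := by
    intro w hw
    rw [mem_rootSet] at hw
    simpa using hroots w (by simpa using hw.2)
  simpa using convexHull_min hsub (convex_closedBall 0 1) hmem

/-- **Bernstein's comparison principle**, off the closed unit disk: domination of `P` by a polynomial
`R` without zeros outside the closed disk passes to the derivatives. -/
theorem norm_eval_derivative_le_of_one_lt {P R : ℂ[X]} (hdeg : 0 < R.degree)
    (hcoeff : ‖P.coeff R.natDegree‖ ≤ ‖R.leadingCoeff‖)
    (hroots : ∀ w, R.eval w = 0 → ‖w‖ ≤ 1)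
    (hle : ∀ w : ℂ, 1 < ‖w‖ → ‖P.eval w‖ ≤ ‖R.eval w‖) {z : ℂ} (hz : 1 < ‖z‖) :
    ‖(derivative P).eval z‖ ≤ ‖(derivative R).eval z‖ := by
  by_contra! hlt
  -- The combination whose derivative vanishes at `z`; it is dominated by its `R`-term, so it
  -- has no zero outside the closed disk.
  set a := (derivative P).eval z with ha
  set b := (derivative R).eval z with hb
  have hR : R ≠ 0 := by rintro rfl; simp at hdeg
  have key : ∀ p r : ℂ, r ≠ 0 → ‖p‖ ≤ ‖r‖ → a * r - b * p ≠ 0 := by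
    intro p r hr hpr h
    have h1 : ‖a‖ * ‖r‖ = ‖b‖ * ‖p‖ := by
      rw [← norm_mul, ← norm_mul, sub_eq_zero.mp h]
    have h2 : ‖b‖ * ‖p‖ ≤ ‖b‖ * ‖r‖ := by gcongr
    have h3 : ‖b‖ * ‖r‖ < ‖a‖ * ‖r‖ := by
      have := norm_pos_iff.mpr hr
      gcongr
    linarith
  have hS : 0 < (C a * R - C b * P).degree := by
    rw [← natDegree_pos_iff_degree_pos]
    refine (natDegree_pos_iff_degree_pos.mpr hdeg).trans_le (le_natDegree_of_ne_zero ?_)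
    simpa using key _ _ (leadingCoeff_ne_zero.mpr hR) hcoeff
  refine absurd (norm_le_one_of_eval_derivative_eq_zero hS (z := z) ?_ ?_) (not_le.mpr hz)
  · intro w hw
    by_contra! hw1
    refine key _ _ (fun h0 ↦ not_le.mpr hw1 (hroots w h0)) (hle w hw1) ?_
    simpa using hw
  · simp [← ha, ← hb, mul_comm]

/-- **Bernstein's comparison principle**, extended to the unit circle by continuity. -/
theorem norm_eval_derivative_le_of_one_le {P R : ℂ[X]} (hdeg : 0 < R.degree)
    (hcoeff : ‖P.coeff R.natDegree‖ ≤ ‖R.leadingCoeff‖)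
    (hroots : ∀ w, R.eval w = 0 → ‖w‖ ≤ 1)
    (hle : ∀ w : ℂ, 1 < ‖w‖ → ‖P.eval w‖ ≤ ‖R.eval w‖) {z : ℂ} (hz : 1 ≤ ‖z‖) :
    ‖(derivative P).eval z‖ ≤ ‖(derivative R).eval z‖ := by
  have hP : Filter.Tendsto (fun t : ℝ ↦ ‖(derivative P).eval (t * z)‖) (nhdsWithin 1 (Set.Ioi 1))
      (nhds ‖(derivative P).eval z‖) := by
    have : Continuous fun t : ℝ ↦ ‖(derivative P).eval (t * z)‖ := by fun_prop
    simpa using (this.tendsto 1).mono_left nhdsWithin_le_nhds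
  have hR : Filter.Tendsto (fun t : ℝ ↦ ‖(derivative R).eval (t * z)‖) (nhdsWithin 1 (Set.Ioi 1))
      (nhds ‖(derivative R).eval z‖) := by
    have : Continuous fun t : ℝ ↦ ‖(derivative R).eval (t * z)‖ := by fun_prop
    simpa using (this.tendsto 1).mono_left nhdsWithin_le_nhds
  refine le_of_tendsto_of_tendsto hP hR ?_
  filter_upwards [self_mem_nhdsWithin] with t (ht : 1 < t)
  refine norm_eval_derivative_le_of_one_lt hdeg hcoeff hroots hle ?_
  rw [norm_mul, Complex.norm_real, Real.norm_of_nonneg (by linarith)]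
  nlinarith

/-! ### Reflecting the zeros into the unit disk -/

/-- Outside the unit disk, the linear factor of a zero `a` is dominated by the factor
`1 - conj a * z`, whose zero `1 / conj a` is the reflection of `a` in the unit circle. -/
theorem norm_sub_le_norm_one_sub_conj_mul {a z : ℂ} (ha : 1 ≤ ‖a‖) (hz : 1 ≤ ‖z‖) :
    ‖z - a‖ ≤ ‖1 - (starRingEnd ℂ) a * z‖ := by
  -- `‖1 - conj a * z‖ ^ 2 - ‖z - a‖ ^ 2 = (1 - ‖a‖ ^ 2) * (1 - ‖z‖ ^ 2)`
  have h1 : 0 ≤ (‖a‖ ^ 2 - 1) * (‖z‖ ^ 2 - 1) :=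
    mul_nonneg (by nlinarith) (by nlinarith)
  refine le_of_sq_le_sq ?_ (norm_nonneg _)
  rw [← Complex.normSq_eq_norm_sq, ← Complex.normSq_eq_norm_sq] at h1
  rw [← Complex.normSq_eq_norm_sq, ← Complex.normSq_eq_norm_sq]
  simp only [Complex.normSq_apply, Complex.sub_re, Complex.sub_im, Complex.mul_re, Complex.mul_im,
    Complex.conj_re, Complex.conj_im, Complex.one_re, Complex.one_im] at h1 ⊢
  nlinarith

/-- Reflecting the outer zeros of a product of linear factors produces a polynomial of the same
degree, with all its zeros in the closed unit disk, which dominates the product outside the disk and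
whose leading coefficient carries the Mahler measure of the product. -/
theorem exists_reflection_prod_X_sub_C (s : Multiset ℂ) :
    ∃ R : ℂ[X], R ≠ 0 ∧ R.natDegree = (s.map fun a ↦ X - C a).prod.natDegree ∧
      ‖R.leadingCoeff‖ = (s.map fun a ↦ X - C a).prod.mahlerMeasure ∧
      (∀ w, R.eval w = 0 → ‖w‖ ≤ 1) ∧
      ∀ w : ℂ, 1 ≤ ‖w‖ → ‖(s.map fun a ↦ X - C a).prod.eval w‖ ≤ ‖R.eval w‖ := by
  induction s using Multiset.induction_on with
  | empty => exact ⟨1, by simp⟩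
  | cons a s ih =>
    obtain ⟨R, hR, hdeg, hlead, hroots, hle⟩ := ih
    have hs : (s.map fun a ↦ X - C a).prod ≠ 0 := (monic_multisetProd_X_sub_C s).ne_zero
    simp only [Multiset.map_cons, Multiset.prod_cons]
    rcases le_or_gt ‖a‖ 1 with ha | ha
    · refine ⟨(X - C a) * R, mul_ne_zero (X_sub_C_ne_zero a) hR, ?_, ?_, ?_, ?_⟩
      · rw [natDegree_mul (X_sub_C_ne_zero a) hR, natDegree_mul (X_sub_C_ne_zero a) hs, hdeg]
      · rw [mahlerMeasure_mul, mahlerMeasure_X_sub_C, max_eq_left ha, leadingCoeff_mul,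
          leadingCoeff_X_sub_C, one_mul, one_mul, hlead]
      · intro w hw
        rw [eval_mul, mul_eq_zero] at hw
        rcases hw with hw | hw
        · rw [eval_sub, eval_X, eval_C, sub_eq_zero] at hw
          rwa [hw]
        · exact hroots w hw
      · intro w hw
        rw [eval_mul, eval_mul, norm_mul, norm_mul]
        gcongr
        exact hle w hw
    · have hconj : -(starRingEnd ℂ) a ≠ 0 := by
        rw [neg_ne_zero, _root_.map_ne_zero, ← norm_pos_iff]
        linarith
      set F : ℂ[X] := C (-(starRingEnd ℂ) a) * X + C 1 with hF
      have hFdeg : F.natDegree = 1 := natDegree_linear hconj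
      have hF0 : F ≠ 0 := by rintro h; simp [h] at hFdeg
      have hFeval : ∀ w, F.eval w = 1 - (starRingEnd ℂ) a * w := fun w ↦ by simp [hF]; ring
      refine ⟨F * R, mul_ne_zero hF0 hR, ?_, ?_, ?_, ?_⟩
      · rw [natDegree_mul hF0 hR, natDegree_mul (X_sub_C_ne_zero a) hs, hdeg, hFdeg,
          natDegree_X_sub_C]
      · rw [mahlerMeasure_mul, mahlerMeasure_X_sub_C, max_eq_right ha.le, leadingCoeff_mul,
          leadingCoeff_linear hconj, norm_mul, norm_neg, RCLike.norm_conj, hlead]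
      · intro w hw
        rw [eval_mul, mul_eq_zero, hFeval] at hw
        rcases hw with hw | hw
        · have h1 : ‖a‖ * ‖w‖ = 1 := by
            rw [← RCLike.norm_conj a, ← norm_mul, ← sub_eq_zero.mp hw, norm_one]
          nlinarith [norm_nonneg w]
        · exact hroots w hw
      · intro w hw
        rw [eval_mul, eval_mul, norm_mul, norm_mul, hFeval, eval_sub, eval_X, eval_C]
        gcongr
        · exact norm_sub_le_norm_one_sub_conj_mul ha.le hw
        · exact hle w hw

theorem exists_reflection {P : ℂ[X]} (hP : P ≠ 0) :
    ∃ R : ℂ[X], R ≠ 0 ∧ R.natDegree = P.natDegree ∧ ‖R.leadingCoeff‖ = P.mahlerMeasure ∧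
      (∀ w, R.eval w = 0 → ‖w‖ ≤ 1) ∧ ∀ w : ℂ, 1 ≤ ‖w‖ → ‖P.eval w‖ ≤ ‖R.eval w‖ := by
  obtain ⟨R, hR, hdeg, hlead, hroots, hle⟩ := exists_reflection_prod_X_sub_C P.roots
  have hc : P.leadingCoeff ≠ 0 := leadingCoeff_ne_zero.mpr hP
  have hfac := (IsAlgClosed.splits P).eq_prod_roots
  set Q := (P.roots.map fun a ↦ X - C a).prod
  refine ⟨C P.leadingCoeff * R, mul_ne_zero (C_ne_zero.mpr hc) hR, ?_, ?_, ?_, ?_⟩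
  · rw [natDegree_C_mul hc, hdeg]
    conv_rhs => rw [hfac, natDegree_C_mul hc]
  · conv_rhs => rw [hfac]
    rw [mahlerMeasure_mul, mahlerMeasure_const, leadingCoeff_mul, leadingCoeff_C, norm_mul, hlead]
  · intro w hw
    rw [eval_mul, eval_C, mul_eq_zero] at hw
    exact hroots w (hw.resolve_left hc)
  · intro w hw
    have h := congrArg (eval w) hfac
    rw [h, eval_mul, eval_mul, norm_mul, norm_mul]
    gcongr
    exact hle w hw

/-! ### Mahler's inequality for the derivative -/

theorem ae_eval_circleMap_ne_zero {P : ℂ[X]} (hP : P ≠ 0) :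
    ∀ᵐ θ : ℝ ∂MeasureTheory.volume.restrict (Set.Icc 0 (2 * Real.pi)),
      P.eval (circleMap 0 1 θ) ≠ 0 := by
  rw [← MeasureTheory.restrict_Ioc_eq_restrict_Icc,
    MeasureTheory.ae_restrict_iff' measurableSet_Ioc]
  refine Set.Finite.measure_zero ?_ _
  simp only [ne_eq, Set.compl_ofPred, Classical.not_imp, Decidable.not_not]
  refine Set.Finite.of_finite_image (f := circleMap 0 1) (P.roots.finite_toSet.subset ?_) ?_
  · rintro z ⟨θ, ⟨_, heval⟩, rfl⟩
    exact (mem_roots hP).mpr heval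
  · refine Set.InjOn.mono (s₂ := Set.Ioc 0 (2 * Real.pi)) (fun θ hθ ↦ hθ.1) ?_
    have := injOn_circleMap_of_abs_sub_le (c := 0) (R := 1) one_ne_zero
      (a := 0) (b := 2 * Real.pi) (by simp [abs_of_pos Real.pi_pos])
    rwa [Set.uIoc_of_le Real.two_pi_pos.le] at this

/-- Monotonicity of the Mahler measure. Since `log 0 = 0`, the logarithms compare only off the
zeros of `P`, which is almost everywhere on the circle. -/
theorem mahlerMeasure_le_of_norm_eval_le {P R : ℂ[X]}
    (hle : ∀ z : ℂ, ‖z‖ = 1 → ‖P.eval z‖ ≤ ‖R.eval z‖) : P.mahlerMeasure ≤ R.mahlerMeasure := by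
  by_cases hP : P = 0
  · simpa [hP] using R.mahlerMeasure_nonneg
  have hR : R ≠ 0 := by
    rintro rfl
    have : (MeasureTheory.ae
        (MeasureTheory.volume.restrict (Set.Icc 0 (2 * Real.pi)))).NeBot := by
      rw [MeasureTheory.ae_neBot, Ne, MeasureTheory.Measure.restrict_eq_zero]
      simp [Real.pi_pos]
    obtain ⟨θ, hθ⟩ := (ae_eval_circleMap_ne_zero hP).exists
    exact hθ (by simpa using hle (circleMap 0 1 θ) (by simp))
  rw [mahlerMeasure_def_of_ne_zero hP, mahlerMeasure_def_of_ne_zero hR]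
  gcongr
  refine intervalIntegral.integral_mono_ae_restrict Real.two_pi_pos.le
    P.intervalIntegrable_mahlerMeasure R.intervalIntegrable_mahlerMeasure ?_
  filter_upwards [ae_eval_circleMap_ne_zero hP] with θ hθ
  exact Real.log_le_log (norm_pos_iff.mpr hθ) (hle _ (by simp))

theorem mahlerMeasure_eq_norm_leadingCoeff {P : ℂ[X]} (hroots : ∀ w, P.eval w = 0 → ‖w‖ ≤ 1) :
    P.mahlerMeasure = ‖P.leadingCoeff‖ := by
  rw [mahlerMeasure_eq_leadingCoeff_mul_prod_roots, Multiset.prod_eq_one, mul_one]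
  intro x hx
  obtain ⟨w, hw, rfl⟩ := Multiset.mem_map.mp hx
  exact max_eq_left (hroots w (isRoot_of_mem_roots hw))

/-- **Mahler's inequality**: the Bernstein inequality for the Mahler measure. -/
theorem mahlerMeasure_derivative_le (P : ℂ[X]) :
    (derivative P).mahlerMeasure ≤ P.natDegree * P.mahlerMeasure := by
  rcases Nat.eq_zero_or_pos P.natDegree with h0 | hpos
  · simp [derivative_eq_zero.mpr h0, h0]
  have hP : P ≠ 0 := by rintro rfl; simp at hpos
  obtain ⟨R, hR, hdeg, hlead, hroots, hle⟩ := exists_reflection hP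
  have hRdeg : 0 < R.degree := natDegree_pos_iff_degree_pos.mp (hdeg ▸ hpos)
  calc (derivative P).mahlerMeasure
      ≤ (derivative R).mahlerMeasure := by
        refine mahlerMeasure_le_of_norm_eval_le fun z hz ↦
          norm_eval_derivative_le_of_one_le hRdeg ?_ hroots (fun w hw ↦ hle w hw.le) hz.ge
        rw [hdeg, hlead]
        exact P.leadingCoeff_le_mahlerMeasure
    _ = ‖(derivative R).leadingCoeff‖ :=
        mahlerMeasure_eq_norm_leadingCoeff fun w hw ↦
          norm_le_one_of_eval_derivative_eq_zero hRdeg hroots hw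
    _ = P.natDegree * P.mahlerMeasure := by
        rw [leadingCoeff_derivative, norm_mul, hlead, hdeg, Complex.norm_natCast, mul_comm]

/-! ### The areal Mahler measure -/

open MeasureTheory in
theorem setIntegral_ball_nonneg_of_circleAverage_nonneg {g : ℂ → ℝ} {R : ℝ}
    (hg : ∀ r ∈ Set.Ioo 0 R, 0 ≤ Real.circleAverage g 0 r) :
    0 ≤ ∫ z in Metric.ball (0 : ℂ) R, g z := by
  rw [← integral_indicator measurableSet_ball, ← Complex.integral_comp_polarCoord_symm,
    polarCoord_target]
  set F : ℝ × ℝ → ℝ := fun p ↦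
    p.1 • (Metric.ball (0 : ℂ) R).indicator g (Complex.polarCoord.symm p) with hF
  -- Where Fubini does not apply, the integral is zero by convention.
  by_cases hint : IntegrableOn F (Set.Ioi 0 ×ˢ Set.Ioo (-Real.pi) Real.pi)
      (volume : Measure (ℝ × ℝ))
  swap
  · exact (integral_undef hint).ge
  rw [Measure.volume_eq_prod] at hint ⊢
  rw [setIntegral_prod _ hint]
  refine setIntegral_nonneg measurableSet_Ioi fun r (hr : 0 < r) ↦ ?_
  have hpolar : ∀ θ : ℝ, Complex.polarCoord.symm (r, θ) = circleMap 0 r θ := fun θ ↦ by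
    rw [Complex.polarCoord_symm_apply, circleMap, Complex.exp_mul_I]
    push_cast
    ring
  simp only [hF, hpolar, smul_eq_mul]
  rw [integral_const_mul]
  refine mul_nonneg hr.le ?_
  rcases lt_or_ge r R with hrR | hrR
  · have hmem : ∀ θ, circleMap 0 r θ ∈ Metric.ball (0 : ℂ) R := fun θ ↦ by
      simpa [abs_of_pos hr] using hrR
    simp only [Set.indicator_of_mem (hmem _)]
    have h := hg r ⟨hr, hrR⟩
    rw [Real.circleAverage_eq_integral_add (-Real.pi), smul_eq_mul,
      mul_nonneg_iff_of_pos_left (by positivity),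
      intervalIntegral.integral_comp_add_right (fun θ ↦ g (circleMap 0 r θ)),
      intervalIntegral.integral_of_le (by linarith [Real.pi_pos]),
      integral_Ioc_eq_integral_Ioo, zero_add, show 2 * Real.pi + -Real.pi = Real.pi by ring] at h
    exact h
  · have hmem : ∀ θ, circleMap 0 r θ ∉ Metric.ball (0 : ℂ) R := fun θ ↦ by
      simpa [abs_of_pos hr] using hrR
    simp [Set.indicator_of_notMem (hmem _)]

open MeasureTheory in
theorem integrableOn_log_norm_ball (R : ℝ) :
    IntegrableOn (fun z : ℂ ↦ Real.log ‖z‖) (Metric.ball 0 R) := by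
  rw [integrableOn_fun_norm_addHaar volume (f := Real.log)]
  simp only [Complex.finrank_real_complex, Nat.add_one_sub_one, pow_one, smul_eq_mul]
  exact (Real.continuous_mul_log.integrableOn_Icc (a := 0) (b := R)).mono_set
    Set.Ioo_subset_Icc_self

open MeasureTheory in
theorem integrableOn_log_norm_sub_ball (a : ℂ) :
    IntegrableOn (fun z : ℂ ↦ Real.log ‖z - a‖) (Metric.ball 0 1) := by
  have h := (integrableOn_log_norm_ball (1 + ‖a‖)).integrable_indicator measurableSet_ball
  refine (h.comp_sub_right a).integrableOn.congr_fun (fun z hz ↦ ?_) measurableSet_ball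
  refine Set.indicator_of_mem ?_ _
  rw [mem_ball_zero_iff] at hz ⊢
  linarith [norm_sub_le z a]

open MeasureTheory in
theorem ae_eval_ne_zero {P : ℂ[X]} (hP : P ≠ 0) :
    ∀ᵐ z : ℂ ∂volume.restrict (Metric.ball 0 1), P.eval z ≠ 0 := by
  refine ae_restrict_of_ae (Set.Finite.measure_zero ?_ _)
  refine P.roots.finite_toSet.subset fun z hz ↦ ?_
  exact (mem_roots hP).mpr (by simpa using hz)

open MeasureTheory in
theorem ae_log_norm_eval_mul {P Q : ℂ[X]} (hP : P ≠ 0) (hQ : Q ≠ 0) :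
    (fun z ↦ Real.log ‖(P * Q).eval z‖) =ᵐ[volume.restrict (Metric.ball 0 1)]
      fun z ↦ Real.log ‖P.eval z‖ + Real.log ‖Q.eval z‖ := by
  filter_upwards [ae_eval_ne_zero hP, ae_eval_ne_zero hQ] with z hPz hQz
  rw [eval_mul, norm_mul, Real.log_mul (norm_ne_zero_iff.mpr hPz) (norm_ne_zero_iff.mpr hQz)]

open MeasureTheory in
theorem integrableOn_log_norm_eval (P : ℂ[X]) :
    IntegrableOn (fun z ↦ Real.log ‖P.eval z‖) (Metric.ball 0 1) := by
  by_cases hP : P = 0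
  · simp [hP]
  have hconst : ∀ c : ℂ, IntegrableOn (fun z ↦ Real.log ‖(C c).eval z‖) (Metric.ball (0 : ℂ) 1) :=
    fun c ↦ by simp
  have hprod : ∀ s : Multiset ℂ, IntegrableOn
      (fun z ↦ Real.log ‖(s.map fun a ↦ X - C a).prod.eval z‖) (Metric.ball (0 : ℂ) 1) := by
    intro s
    induction s using Multiset.induction_on with
    | empty => simp
    | cons a s ih =>
      rw [Multiset.map_cons, Multiset.prod_cons]
      refine Integrable.congr ?_ (ae_log_norm_eval_mul (X_sub_C_ne_zero a)
        (monic_multisetProd_X_sub_C s).ne_zero).symm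
      refine Integrable.add ?_ ih
      simpa [IntegrableOn] using integrableOn_log_norm_sub_ball a
  rw [(IsAlgClosed.splits P).eq_prod_roots]
  exact Integrable.congr ((hconst _).add (hprod _)) (ae_log_norm_eval_mul
    (C_ne_zero.mpr (leadingCoeff_ne_zero.mpr hP)) (monic_multisetProd_X_sub_C _).ne_zero).symm

theorem arealMahlerMeasure_zero : arealMahlerMeasure 0 = 0 := if_pos rfl

theorem arealMahlerMeasure_of_ne_zero {P : ℂ[X]} (hP : P ≠ 0) : arealMahlerMeasure P =
    Real.exp ((1 / Real.pi) * ∫ z in Metric.ball (0 : ℂ) 1, Real.log ‖P.eval z‖) :=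
  if_neg hP

theorem arealMahlerMeasure_nonneg (P : ℂ[X]) : 0 ≤ arealMahlerMeasure P := by
  unfold arealMahlerMeasure
  split_ifs
  · exact le_rfl
  · positivity

theorem arealMahlerMeasure_mul (P Q : ℂ[X]) :
    arealMahlerMeasure (P * Q) = arealMahlerMeasure P * arealMahlerMeasure Q := by
  by_cases hP : P = 0
  · simp [hP, arealMahlerMeasure_zero]
  by_cases hQ : Q = 0
  · simp [hQ, arealMahlerMeasure_zero]
  rw [arealMahlerMeasure_of_ne_zero hP, arealMahlerMeasure_of_ne_zero hQ,
    arealMahlerMeasure_of_ne_zero (mul_ne_zero hP hQ), ← Real.exp_add, ← mul_add,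
    MeasureTheory.integral_congr_ae (ae_log_norm_eval_mul hP hQ),
    MeasureTheory.integral_add (integrableOn_log_norm_eval P) (integrableOn_log_norm_eval Q)]

theorem arealMahlerMeasure_C (c : ℂ) : arealMahlerMeasure (C c) = ‖c‖ := by
  by_cases hc : c = 0
  · simp [hc, arealMahlerMeasure_zero]
  rw [arealMahlerMeasure_of_ne_zero (C_ne_zero.mpr hc)]
  have hvol : MeasureTheory.volume.real (Metric.ball (0 : ℂ) 1) = Real.pi := by
    simp [MeasureTheory.measureReal_def]
  simp only [eval_C, MeasureTheory.setIntegral_const, hvol, smul_eq_mul]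
  rw [one_div, inv_mul_cancel_left₀ Real.pi_ne_zero, Real.exp_log (norm_pos_iff.mpr hc)]

open MeasureTheory in
/-- `∬ log |z| dA = 2 π ∫₀¹ r log r dr = - π / 2`. -/
theorem integral_log_norm_unit_ball :
    ∫ z in Metric.ball (0 : ℂ) 1, Real.log ‖z‖ = -Real.pi / 2 := by
  have hind : (Metric.ball (0 : ℂ) 1).indicator (fun z ↦ Real.log ‖z‖) =
      fun z ↦ (Set.Iio 1).indicator Real.log ‖z‖ := by
    ext z
    by_cases hz : ‖z‖ < 1 <;> simp [Set.indicator, hz]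
  have hprim : ∫ y in (0 : ℝ)..1, y * Real.log y = -(1 / 4) := by
    rw [intervalIntegral.integral_eq_sub_of_hasDerivAt_of_le
      (f := fun y ↦ y * (y * Real.log y) / 2 - y ^ 2 / 4) zero_le_one]
    · norm_num
    · have := Real.continuous_mul_log
      fun_prop
    · intro y hy
      have hlog := Real.hasDerivAt_log hy.1.ne'
      have hy0 := hy.1.ne'
      convert! (((hasDerivAt_id y).mul ((hasDerivAt_id y).mul hlog)).div_const 2).sub
        ((hasDerivAt_pow 2 y).div_const 4) using 1
      simp
      field_simp
      ring
    · exact Real.continuous_mul_log.intervalIntegrable 0 1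
  have hradial : ∫ y in Set.Ioi (0 : ℝ), y * (Set.Iio 1).indicator Real.log y = -(1 / 4) := by
    have hfun : (fun y : ℝ ↦ y * (Set.Iio 1).indicator Real.log y) =
        (Set.Iio 1).indicator fun y ↦ y * Real.log y := by
      ext y
      by_cases hy : y < 1 <;> simp [Set.indicator, hy]
    rw [hfun, setIntegral_indicator measurableSet_Iio, Set.Ioi_inter_Iio, ← integral_Ioc_eq_integral_Ioo,
      ← intervalIntegral.integral_of_le zero_le_one, hprim]
  rw [← integral_indicator measurableSet_ball, hind,
    integral_fun_norm_addHaar volume ((Set.Iio 1).indicator Real.log)]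
  simp only [Complex.finrank_real_complex, Nat.add_one_sub_one, pow_one, smul_eq_mul, hradial]
  simp [measureReal_def]
  ring

theorem arealMahlerMeasure_X : arealMahlerMeasure X = Real.exp (-(1 / 2)) := by
  rw [arealMahlerMeasure_of_ne_zero X_ne_zero]
  simp only [eval_X, integral_log_norm_unit_ball]
  congr 1
  field_simp

/-- The areal Mahler measure averages the logarithmic Mahler measures of the dilations
`P (r z)`, `0 < r < 1`, hence is monotone in them. -/
theorem arealMahlerMeasure_le_of_dilations {P Q : ℂ[X]} (hQ : Q ≠ 0)
    (hle : ∀ r ∈ Set.Ioo (0 : ℝ) 1,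
      (P.comp (C (r : ℂ) * X)).mahlerMeasure ≤ (Q.comp (C (r : ℂ) * X)).mahlerMeasure) :
    arealMahlerMeasure P ≤ arealMahlerMeasure Q := by
  by_cases hP : P = 0
  · rw [hP, arealMahlerMeasure_zero]
    exact arealMahlerMeasure_nonneg Q
  rw [arealMahlerMeasure_of_ne_zero hP, arealMahlerMeasure_of_ne_zero hQ]
  refine Real.exp_le_exp.mpr (mul_le_mul_of_nonneg_left ?_ (by positivity))
  rw [← sub_nonneg, ← MeasureTheory.integral_sub (integrableOn_log_norm_eval Q)
    (integrableOn_log_norm_eval P)]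
  refine setIntegral_ball_nonneg_of_circleAverage_nonneg fun r hr ↦ ?_
  have hcirc : ∀ A : ℂ[X], CircleIntegrable (fun z ↦ Real.log ‖A.eval z‖) 0 r := fun A ↦
    (analyticOnNhd_id.aeval_polynomial A).meromorphicOn.circleIntegrable_log_norm
  have hlog : ∀ A : ℂ[X], Real.circleAverage (fun z ↦ Real.log ‖A.eval z‖) 0 r =
      Real.log (A.comp (C (r : ℂ) * X)).mahlerMeasure := fun A ↦ by
    rw [Real.circleAverage_eq_circleAverage_zero_one, ← logMahlerMeasure_eq_log_MahlerMeasure,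
      logMahlerMeasure_def]
    simp
  rw [Real.circleAverage_fun_sub (hcirc Q) (hcirc P), hlog, hlog, sub_nonneg]
  refine Real.log_le_log (mahlerMeasure_pos_of_ne_zero ?_) (hle r hr)
  have hr0 : (r : ℂ) ≠ 0 := by exact_mod_cast hr.1.ne'
  rw [Ne, comp_eq_zero_iff]
  rintro (h | ⟨-, h⟩)
  · exact hP h
  · have := congrArg (fun A : ℂ[X] ↦ A.coeff 1) h
    simp [hr0] at this

theorem arealMahlerMeasure_X_mul_derivative_le {n : ℕ} {P : ℂ[X]} (hP : P.natDegree ≤ n) :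
    arealMahlerMeasure (X * derivative P) ≤ n * arealMahlerMeasure P := by
  by_cases hD : derivative P = 0
  · rw [hD, mul_zero, arealMahlerMeasure_zero]
    exact mul_nonneg n.cast_nonneg (arealMahlerMeasure_nonneg P)
  have hP0 : P ≠ 0 := by rintro rfl; simp at hD
  have hn : (n : ℂ) ≠ 0 := by
    rw [Nat.cast_ne_zero]
    rintro rfl
    exact hD (derivative_eq_zero.mpr (Nat.le_zero.mp hP))
  have hC : ∀ A : ℂ[X], (n : ℝ) * arealMahlerMeasure A = arealMahlerMeasure (C (n : ℂ) * A) :=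
    fun A ↦ by rw [arealMahlerMeasure_mul, arealMahlerMeasure_C, Complex.norm_natCast]
  rw [hC]
  refine arealMahlerMeasure_le_of_dilations (mul_ne_zero (C_ne_zero.mpr hn) hP0) fun r hr ↦ ?_
  set Q := P.comp (C (r : ℂ) * X) with hQ
  -- The Euler operator `z d/dz` commutes with dilations.
  have hcomm : (X * derivative P).comp (C (r : ℂ) * X) = X * derivative Q := by
    rw [hQ, derivative_comp, mul_comp, X_comp]
    simp
    ring
  have hdeg : Q.natDegree ≤ n := by
    rw [hQ, natDegree_comp]
    calc P.natDegree * (C (r : ℂ) * X).natDegree ≤ P.natDegree * 1 := by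
          gcongr
          compute_degree
      _ ≤ n := by rwa [mul_one]
  rw [hcomm, mul_comp, C_comp, mahlerMeasure_mul, mahlerMeasure_mul, mahlerMeasure_const,
    Complex.norm_natCast]
  have hX : (X : ℂ[X]).mahlerMeasure = 1 := by
    simpa using mahlerMeasure_X_sub_C (0 : ℂ)
  rw [hX, one_mul]
  refine (mahlerMeasure_derivative_le Q).trans ?_
  gcongr
  exact Q.mahlerMeasure_nonneg

theorem arealMahlerMeasure_eq_sqrt_exp_mul (P : ℂ[X]) :
    arealMahlerMeasure P = Real.sqrt (Real.exp 1) * arealMahlerMeasure (X * P) := by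
  rw [arealMahlerMeasure_mul, arealMahlerMeasure_X, ← mul_assoc, ← Real.exp_half, ← Real.exp_add]
  simp

theorem arealMahlerMeasure_X_mul_derivative_X_pow (n : ℕ) :
    arealMahlerMeasure (X * derivative (X ^ n : ℂ[X])) =
      n * arealMahlerMeasure (X ^ n : ℂ[X]) := by
  have h : X * derivative (X ^ n : ℂ[X]) = C (n : ℂ) * X ^ n := by
    rcases n with _ | n
    · simp
    · rw [derivative_X_pow, Nat.add_sub_cancel]
      ring
  rw [h, arealMahlerMeasure_mul, arealMahlerMeasure_C, Complex.norm_natCast]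

theorem corollary3p2 (n : ℕ) :
    (∀ P : ℂ[X], P.natDegree ≤ n →
      arealMahlerMeasure (X * derivative P) ≤ n * arealMahlerMeasure P ∧
      arealMahlerMeasure (derivative P) ≤
        Real.sqrt (Real.exp 1) * n * arealMahlerMeasure P) ∧
    arealMahlerMeasure (X * derivative (X ^ n : ℂ[X])) =
      n * arealMahlerMeasure (X ^ n : ℂ[X]) ∧
    arealMahlerMeasure (derivative (X ^ n : ℂ[X])) =
      Real.sqrt (Real.exp 1) * n * arealMahlerMeasure (X ^ n : ℂ[X]) := by
  refine ⟨fun P hP ↦ ⟨arealMahlerMeasure_X_mul_derivative_le hP, ?_⟩,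
    arealMahlerMeasure_X_mul_derivative_X_pow n, ?_⟩
  · rw [arealMahlerMeasure_eq_sqrt_exp_mul, mul_assoc]
    gcongr
    exact arealMahlerMeasure_X_mul_derivative_le hP
  · rw [arealMahlerMeasure_eq_sqrt_exp_mul, arealMahlerMeasure_X_mul_derivative_X_pow, mul_assoc]
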